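/- **Setting.** Let $d\ge 0$, $K\ge 3$, $S=\mathbb R^d$, $\overline H_+=[0,\infty)\times S\subset\mathbb R\times S=\mathbb R^{d+1}$. The open book $\mathcal O$ is obtained from $\overline H_+\times\{1,\dots,K\}$ by identifying the boundaries $\{0\}\times S$ of the $K$ copies. Its leaves are $L_k$ (the image of $\overline H_+\times\{k\}$), its spine is the common boundary $L_0\cong S$, and $L_k^+=L_k\setminus L_0$. With $R(x^{(0)},y)=(-x^{(0)},y)$, the metric is $d\big((x,k),(y,j)\big)=|x-y|$ if $k=j$ and $|x-Ry|$ if $k\ne j$. Let $P_S:\mathcal O\to S$, $(x^{(0)},y,k)\mapsto y$; let $F_k:\mathcal O\to\mathbb R^{d+1}$ be the folding map, $F_k(x,k)=x$ and $F_k(x,j)=Rx$ for $j\neq k$; and write $F_k^{-1}:\overline H_+\to L_k$ for the inverse of $F_k|_{L_k}$. Let $\lambda(x,k)=(\lambda x,k)$ for $\lambda\ge 0$. Let $\mu$ be a Borel probability measure on $\mathcal O$ with $\int d(0,q)^2\,d\mu(q)<\infty$ that is nondegenerate: $\mu(L_k^+)>0$ for all $k$. Put $m_k=\int x^{(0)}\,d(\mu\circ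 F_k^{-1})(x)$, where $\mu\circ F_k^{-1}$ is the pushforward of $\mu$ under $F_k$. The mean of $\mu$ is *sticky* if $m_j<0$ for all $j$, *nonsticky* if $m_k>0$ for some $k$, and *partly sticky* if $m_k=0$ for some $k$. Let $p_1,p_2,\dots$ be independent random points of $\mathcal O$ with law $\mu$. Let $\bar b$ be the Fréchet mean of $\mu$, the minimizer of $p\mapsto\int d(p,q)^2\,d\mu(q)$, let $b_N$ be the barycenter of $p_1,\dots,p_N$, the minimizer of $p\mapsto\sum_{n\le N}d(p,p_n)^2$, and let $\nu_N$ be the law of $\sqrt N\,b_N$. Let $g_S$ be the centred Gaussian measure on $S$ with covariance $C_S=\int (P_Sp)(P_Sp)^T\,d\mu(p)$, and $g_k$ the centred Gaussian measure on $\mathbb R^{d+1}$ with covariance $C_k=\int (F_kp)(F_kp)^T\,d\mu(p)$. Let $h_k^0$ be the measure on $S\cong\{0\}\times S$ with $h_k^0(B)=g_S(B)-g_k((0,\infty)\times B)$, and let $h_k$ be the measure on $\overline H_+\cong L_k$ with $h_k(A)=h_k^0(A\cap(\{0\}\times S))+g_k(A)$. **Theorem (Sticky CLT).** The minimizers $\bar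 b$ and $b_N$ ($N\ge1$) exist and are unique, and $b_N$ is a measurable function on the probability space. Moreover: 1. If $P_S\bar b=0$ and the mean of $\mu$ is sticky, then for every bounded continuous $\phi:\mathcal O\to\mathbb R$, $$\lim_{N\to\infty}\int_{\mathcal O}\phi\,d\nu_N=\int_S\phi\circ(P_S|_{L_0})^{-1}\,dg_S .$$ 2. If the mean of $\mu$ is nonsticky, with $m_k>0$, then for every bounded continuous $\phi:\mathbb R^{d+1}\to\mathbb R$, with $\tilde g_k$ the centred Gaussian measure on $\mathbb R^{d+1}$ with covariance $\int (F_kp-F_k\bar b)(F_kp-F_k\bar b)^T\,d\mu(p)$, $$\lim_{N\to\infty}\mathbb E\,\phi\big(\sqrt N(F_kb_N-F_k\bar b)\big)=\int_{\mathbb R^{d+1}}\phi\,d\tilde g_k .$$ 3. If $P_S\bar b=0$ and the mean of $\mu$ is partly sticky, with $m_k=0$, then for every bounded continuous $\phi:\mathcal O\to\mathbb R$, $$\lim_{N\to\infty}\int_{\mathcal O}\phi\,d\nu_N=\int_{\overline H_+}\phi\circ F_k^{-1}\,dh_k ,$$ and $h_k$ is the pushforward of $g_k$ under the convex projection $\hat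 P:\mathbb R^{d+1}\to\overline H_+$, $\hat P(x^{(0)},y)=(\max(x^{(0)},0),y)$. -/

import Mathlib

open MeasureTheory ProbabilityTheory Filter Topology
open scoped NNReal BoundedContinuousFunction

noncomputable section

namespace OpenBook

/-- The space `ℝ^{d+1} = ℝ × S`; the coordinate `0` is transverse to the spine. -/
abbrev Ambient (d : ℕ) : Type := EuclideanSpace ℝ (Fin (d + 1))

/-- The vector space `S = ℝ^d`. -/
abbrev Spine (d : ℕ) : Type := EuclideanSpace ℝ (Fin d)

/-- The closed half-space `[0, ∞) × S`, with its subspace metric, topology and Borel sets. -/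
abbrev HalfSpace (d : ℕ) : Type := {x : Ambient d // 0 ≤ x 0}

/-- The point `(t, y)` of `ℝ × S`. -/
def pt {d : ℕ} (t : ℝ) (y : Spine d) : Ambient d :=
  WithLp.toLp 2 (Fin.cons t (fun i => y i) : Fin (d + 1) → ℝ)

/-- The orthogonal projection of `ℝ × S` to `S`. -/
def projS {d : ℕ} (x : Ambient d) : Spine d :=
  WithLp.toLp 2 (fun i : Fin d => x i.succ)

/-- Reflection across the hyperplane `{0} × S`. -/
def reflect {d : ℕ} (x : Ambient d) : Ambient d := pt (-x 0) (projS x)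

/-- `S` as the boundary hyperplane of the half-space. -/
def spineHalf {d : ℕ} (y : Spine d) : HalfSpace d := ⟨pt 0 y, le_refl (0 : ℝ)⟩

/-- The convex projection of `ℝ^{d+1}` onto the closed half-space. -/
def convexProj {d : ℕ} (x : Ambient d) : HalfSpace d :=
  if h : x 0 < 0 then spineHalf (projS x) else ⟨x, not_lt.mp h⟩

@[simp] lemma pt_zero {d : ℕ} (t : ℝ) (y : Spine d) : pt t y 0 = t := rfl

@[simp] lemma pt_succ {d : ℕ} (t : ℝ) (y : Spine d) (i : Fin d) : pt t y i.succ = y i := rfl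

@[simp] lemma projS_apply {d : ℕ} (x : Ambient d) (i : Fin d) : projS x i = x i.succ := rfl

@[simp] lemma reflect_zero {d : ℕ} (x : Ambient d) : reflect x 0 = -x 0 := rfl

@[simp] lemma reflect_succ {d : ℕ} (x : Ambient d) (i : Fin d) :
    reflect x i.succ = x i.succ := rfl

lemma reflect_of_zero {d : ℕ} {x : Ambient d} (h : x 0 = 0) : reflect x = x := by
  ext i
  refine Fin.cases ?_ (fun i => ?_) i
  · simp [h]
  · simp

lemma norm_sub_sq {d : ℕ} (x y : Ambient d) :
    ‖x - y‖ ^ 2 = (x 0 - y 0) ^ 2 + ∑ i : Fin d, (x i.succ - y i.succ) ^ 2 := by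
  rw [EuclideanSpace.real_norm_sq_eq, Fin.sum_univ_succ]
  simp

lemma norm_reflect_sub_reflect {d : ℕ} (x y : Ambient d) :
    ‖reflect x - reflect y‖ = ‖x - y‖ := by
  have h : ‖reflect x - reflect y‖ ^ 2 = ‖x - y‖ ^ 2 := by
    rw [norm_sub_sq, norm_sub_sq]
    simp only [reflect_zero, reflect_succ]
    ring
  exact (sq_eq_sq₀ (norm_nonneg _) (norm_nonneg _)).1 h

lemma norm_reflect_sub {d : ℕ} (x y : Ambient d) : ‖reflect x - y‖ = ‖x - reflect y‖ := by
  have h : ‖reflect x - y‖ ^ 2 = ‖x - reflect y‖ ^ 2 := by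
    rw [norm_sub_sq, norm_sub_sq]
    simp only [reflect_zero, reflect_succ]
    ring
  exact (sq_eq_sq₀ (norm_nonneg _) (norm_nonneg _)).1 h

lemma norm_sub_le_norm_sub_reflect {d : ℕ} (x y : HalfSpace d) :
    ‖x.1 - y.1‖ ≤ ‖x.1 - reflect y.1‖ := by
  have h : ‖x.1 - y.1‖ ^ 2 ≤ ‖x.1 - reflect y.1‖ ^ 2 := by
    rw [norm_sub_sq, norm_sub_sq]
    simp only [reflect_zero, reflect_succ]
    nlinarith [mul_nonneg x.2 y.2]
  exact (sq_le_sq₀ (norm_nonneg _) (norm_nonneg _)).1 h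

/-- Two points of the disjoint union of `K` half-spaces are identified when they are equal or
both are the same boundary point. -/
def glue (d K : ℕ) : Setoid (HalfSpace d × Fin K) where
  r p q := p = q ∨ (p.1.1 0 = 0 ∧ p.1 = q.1)
  iseqv := by
    refine ⟨fun p => Or.inl rfl, ?_, ?_⟩
    · rintro p q (rfl | ⟨h, e⟩)
      · exact Or.inl rfl
      · exact Or.inr ⟨e ▸ h, e.symm⟩
    · rintro p q r (rfl | ⟨h, e⟩) (rfl | ⟨h', e'⟩)
      · exact Or.inl rfl
      · exact Or.inr ⟨h', e'⟩
      · exact Or.inr ⟨h, e⟩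
      · exact Or.inr ⟨h, e.trans e'⟩

end OpenBook

/-- The open book with spine `ℝ^d` and `K` leaves. -/
def OpenBook (d K : ℕ) : Type := Quotient (OpenBook.glue d K)

namespace OpenBook

variable {d K : ℕ}

/-- The point of the `k`-th leaf with coordinate `x`. -/
def mk (x : HalfSpace d) (k : Fin K) : OpenBook d K := Quotient.mk (glue d K) (x, k)

/-- The folding map: the `k`-th leaf goes to the half-space, and every other leaf to its mirror
image. -/
def fold (k : Fin K) : OpenBook d K → Ambient d :=
  Quotient.lift (fun p : HalfSpace d × Fin K => if p.2 = k then p.1.1 else reflect p.1.1) (by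
    rintro ⟨x, i⟩ ⟨y, j⟩ (h | ⟨h, e⟩)
    · rw [h]
    · obtain rfl : x = y := e
      have h' : x.1 0 = 0 := h
      simp [reflect_of_zero h'])

/-- The projection of the open book to its spine. -/
def spineProj : OpenBook d K → Spine d :=
  Quotient.lift (fun p : HalfSpace d × Fin K => projS p.1.1) (by
    rintro ⟨x, i⟩ ⟨y, j⟩ (h | ⟨h, e⟩)
    · rw [h]
    · obtain rfl : x = y := e
      rfl)

/-- The distance: Euclidean inside one leaf, and Euclidean after reflecting one of the two points
when they lie on different leaves. -/
def bookDist : OpenBook d K → OpenBook d K → ℝ :=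
  Quotient.lift₂
    (fun p q : HalfSpace d × Fin K =>
      if p.2 = q.2 then ‖p.1.1 - q.1.1‖ else ‖p.1.1 - reflect q.1.1‖) (by
    rintro ⟨x, i⟩ ⟨y, j⟩ ⟨x', i'⟩ ⟨y', j'⟩ hx hy
    have key : ∀ (x y : HalfSpace d), x.1 0 = 0 ∨ y.1 0 = 0 →
        ‖x.1 - reflect y.1‖ = ‖x.1 - y.1‖ := by
      rintro x y (h | h)
      · rw [← norm_reflect_sub, reflect_of_zero h]
      · rw [reflect_of_zero h]
    rcases hx with hx | ⟨hx, ex⟩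
    · obtain ⟨rfl, rfl⟩ := Prod.mk.inj hx
      rcases hy with hy | ⟨hy, ey⟩
      · obtain ⟨rfl, rfl⟩ := Prod.mk.inj hy
        rfl
      · obtain rfl : y = y' := ey
        simp [key x y (Or.inr hy)]
    · obtain rfl : x = x' := ex
      have hyy : y = y' := by
        rcases hy with hy | ⟨hy, ey⟩
        · exact (Prod.mk.inj hy).1
        · exact ey
      subst hyy
      simp [key x y (Or.inl hx)])

lemma fold_mk_self (x : HalfSpace d) (k : Fin K) : fold k (mk x k) = x.1 := by
  simp [fold, mk]

lemma fold_mk_of_ne (x : HalfSpace d) {j k : Fin K} (h : j ≠ k) :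
    fold k (mk x j) = reflect x.1 := by
  simp [fold, mk, h]

lemma bookDist_mk (x y : HalfSpace d) (k j : Fin K) :
    bookDist (mk x k) (mk y j) = if k = j then ‖x.1 - y.1‖ else ‖x.1 - reflect y.1‖ := rfl

lemma bookDist_mk_left (x : HalfSpace d) (k : Fin K) (q : OpenBook d K) :
    bookDist (mk x k) q = ‖fold k (mk x k) - fold k q‖ := by
  obtain ⟨⟨y, j⟩, rfl⟩ := Quotient.exists_rep q
  change bookDist (mk x k) (mk y j) = ‖_ - fold k (mk y j)‖
  by_cases h : k = j
  · subst h
    rw [fold_mk_self, fold_mk_self, bookDist_mk, if_pos rfl]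
  · rw [fold_mk_self, fold_mk_of_ne _ (Ne.symm h), bookDist_mk, if_neg h]

lemma norm_fold_sub_le (k : Fin K) (p q : OpenBook d K) :
    ‖fold k p - fold k q‖ ≤ bookDist p q := by
  obtain ⟨⟨x, i⟩, rfl⟩ := Quotient.exists_rep p
  obtain ⟨⟨y, j⟩, rfl⟩ := Quotient.exists_rep q
  change ‖fold k (mk x i) - fold k (mk y j)‖ ≤ bookDist (mk x i) (mk y j)
  rw [bookDist_mk]
  by_cases hi : i = k <;> by_cases hj : j = k
  · subst hi; subst hj
    simp [fold_mk_self]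
  · subst hi
    rw [fold_mk_self, fold_mk_of_ne _ hj, if_neg (Ne.symm hj)]
  · subst hj
    rw [fold_mk_self, fold_mk_of_ne _ hi, if_neg hi, norm_reflect_sub]
  · rw [fold_mk_of_ne _ hi, fold_mk_of_ne _ hj, norm_reflect_sub_reflect]
    split_ifs
    · exact le_rfl
    · exact norm_sub_le_norm_sub_reflect x y

instance : MetricSpace (OpenBook d K) where
  dist := bookDist
  dist_self p := by
    obtain ⟨⟨x, i⟩, rfl⟩ := Quotient.exists_rep p
    change bookDist (mk x i) (mk x i) = 0
    simp [bookDist_mk]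
  dist_comm p q := by
    obtain ⟨⟨x, i⟩, rfl⟩ := Quotient.exists_rep p
    obtain ⟨⟨y, j⟩, rfl⟩ := Quotient.exists_rep q
    change bookDist (mk x i) (mk y j) = bookDist (mk y j) (mk x i)
    rw [bookDist_mk, bookDist_mk]
    by_cases h : i = j
    · rw [if_pos h, if_pos h.symm, norm_sub_rev]
    · rw [if_neg h, if_neg (Ne.symm h), ← norm_reflect_sub, norm_sub_rev]
  dist_triangle p q r := by
    obtain ⟨⟨x, k⟩, rfl⟩ := Quotient.exists_rep p
    change bookDist (mk x k) r ≤ bookDist (mk x k) q + bookDist q r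
    rw [bookDist_mk_left, bookDist_mk_left]
    exact (norm_sub_le_norm_sub_add_norm_sub _ (fold k q) _).trans
      (by gcongr; exact norm_fold_sub_le k q r)
  eq_of_dist_eq_zero := by
    intro p q h
    obtain ⟨⟨x, i⟩, rfl⟩ := Quotient.exists_rep p
    obtain ⟨⟨y, j⟩, rfl⟩ := Quotient.exists_rep q
    change bookDist (mk x i) (mk y j) = 0 at h
    rw [bookDist_mk] at h
    split_ifs at h with hij
    · have hxy : x = y := Subtype.ext (sub_eq_zero.1 (norm_eq_zero.1 h))
      rw [hxy, hij]
    · have hxy : x = y := Subtype.ext (sub_eq_zero.1 (norm_eq_zero.1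
        (le_antisymm ((norm_sub_le_norm_sub_reflect x y).trans h.le) (norm_nonneg _))))
      subst hxy
      have h0 : x.1 0 = (reflect x.1) 0 := by rw [← sub_eq_zero.1 (norm_eq_zero.1 h)]
      rw [reflect_zero] at h0
      exact Quotient.sound (Or.inr ⟨by change x.1 0 = 0; linarith, rfl⟩)

instance : MeasurableSpace (OpenBook d K) := borel _

instance : BorelSpace (OpenBook d K) := ⟨rfl⟩

/-- Scaling by a nonnegative real number, leaf by leaf. -/
instance : SMul ℝ≥0 (OpenBook d K) where
  smul c := Quotient.map'
    (fun p : HalfSpace d × Fin K =>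
      ((⟨(c : ℝ) • p.1.1, mul_nonneg c.2 p.1.2⟩ : HalfSpace d), p.2)) (by
    rintro ⟨x, i⟩ ⟨y, j⟩ (h | ⟨h, e⟩)
    · rw [h]
    · obtain rfl : x = y := e
      have h' : x.1 0 = 0 := h
      exact Or.inr ⟨by simp [h'], rfl⟩)

/-- The point of the open book that lies on the spine at `y`. -/
def spinePt [hK : Fact (3 ≤ K)] (y : Spine d) : OpenBook d K :=
  mk (spineHalf y) ⟨0, lt_of_lt_of_le (by norm_num) hK.out⟩

/-- The open leaf: the `k`-th leaf without the spine. -/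
def openLeaf (d : ℕ) {K : ℕ} (k : Fin K) : Set (OpenBook d K) :=
  {p | ∃ x : HalfSpace d, 0 < x.1 0 ∧ p = mk x k}

/-- Every open leaf has positive mass. -/
def Nondegenerate (μ : Measure (OpenBook d K)) : Prop := ∀ k : Fin K, 0 < μ (openLeaf d k)

/-- The second moment of `μ` is finite. -/
def FiniteSecondMoment [Fact (3 ≤ K)] (μ : Measure (OpenBook d K)) : Prop :=
  Integrable (fun q : OpenBook d K => dist (spinePt 0) q ^ 2) μ

/-- The first moment of `μ` on the `k`-th leaf. -/
def moment (μ : Measure (OpenBook d K)) (k : Fin K) : ℝ := ∫ x, x 0 ∂(μ.map (fold k))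

/-- The mean of `μ` is sticky. -/
def Sticky (μ : Measure (OpenBook d K)) : Prop := ∀ j : Fin K, moment μ j < 0

/-- `b` is a Fréchet mean of `μ`. -/
def IsFrechetMean (μ : Measure (OpenBook d K)) (b : OpenBook d K) : Prop :=
  ∀ p, ∫ q, dist b q ^ 2 ∂μ ≤ ∫ q, dist p q ^ 2 ∂μ

/-- `b` is a barycenter (sample Fréchet mean) of the points `x 0, …, x (N - 1)`. -/
def IsBarycenter {N : ℕ} (x : Fin N → OpenBook d K) (b : OpenBook d K) : Prop :=
  ∀ p, ∑ n, dist b (x n) ^ 2 ≤ ∑ n, dist p (x n) ^ 2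

instance [Fact (3 ≤ K)] : Nonempty (OpenBook d K) := ⟨spinePt 0⟩

/-- The Fréchet mean of `μ`. -/
def frechetMean [Fact (3 ≤ K)] (μ : Measure (OpenBook d K)) : OpenBook d K :=
  Classical.epsilon (IsFrechetMean μ)

/-- The barycenter of a finite sample. -/
def barycenter [Fact (3 ≤ K)] {N : ℕ} (x : Fin N → OpenBook d K) : OpenBook d K :=
  Classical.epsilon (IsBarycenter x)

/-- The empirical mean of the first `N` points of a random sequence. -/
def empiricalMean [Fact (3 ≤ K)] {Ω : Type*} (p : ℕ → Ω → OpenBook d K) (N : ℕ) (ω : Ω) :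
    OpenBook d K :=
  barycenter (fun n : Fin N => p n ω)

/-- The law of the rescaled empirical mean. -/
def rescaledLaw [Fact (3 ≤ K)] {Ω : Type*} [MeasurableSpace Ω] (P : Measure Ω)
    (p : ℕ → Ω → OpenBook d K) (N : ℕ) : Measure (OpenBook d K) :=
  P.map (fun ω => NNReal.sqrt (N : ℝ≥0) • empiricalMean p N ω)

/-- The matrix of second moments of `μ` projected to the spine. -/
def spinalCov (μ : Measure (OpenBook d K)) : Matrix (Fin d) (Fin d) ℝ :=
  Matrix.of fun i j => ∫ y, y i * y j ∂(μ.map spineProj)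

/-- The spinal limit measure. -/
def spinalLimit (μ : Measure (OpenBook d K)) : Measure (Spine d) :=
  multivariateGaussian 0 (spinalCov μ)

/-- The matrix of second moments about `a` of `μ` folded along the `k`-th leaf. -/
def foldedCov (μ : Measure (OpenBook d K)) (k : Fin K) (a : Ambient d) :
    Matrix (Fin (d + 1)) (Fin (d + 1)) ℝ :=
  Matrix.of fun i j => ∫ x, (x i - a i) * (x j - a j) ∂(μ.map (fold k))

/-- The costal limit measure. -/
def costalLimit (μ : Measure (OpenBook d K)) (k : Fin K) : Measure (Ambient d) :=
  multivariateGaussian 0 (foldedCov μ k 0)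

/-- The semispinal limit measure, on the spine: the measure
`B ↦ spinalLimit B - costalLimit ((0, ∞) × B)`. -/
def semispinalLimit (μ : Measure (OpenBook d K)) (k : Fin K) : Measure (Spine d) :=
  spinalLimit μ - ((costalLimit μ k).restrict {x | 0 < x 0}).map projS

/-- The spinocostal limit measure, on the closed half-space (identified with the `k`-th leaf by
`x ↦ mk x k`): the semispinal limit measure on the boundary plus the costal limit measure. -/
def spinocostalLimit (μ : Measure (OpenBook d K)) (k : Fin K) : Measure (HalfSpace d) :=
  (semispinalLimit μ k).map spineHalf + (costalLimit μ k).comap Subtype.val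

end OpenBook

end

namespace OpenBook

variable {d K : ℕ}

/-! ### Geometry of the open book -/

/-! Seen from a point of leaf `k`, the book is Euclidean: the distance from `mk x k` to `q` is
exactly `‖x - fold k q‖`. Hence on leaf `k` the Fréchet function is `‖x - foldedMean μ k‖ ^ 2 -
‖foldedMean μ k‖ ^ 2` plus a constant independent of `k`, and its minimizer there is the convex
projection of the folded mean. For `j ≠ k` the heights `fold j q 0` and `fold k q 0` have
nonpositive sum, so at most one folded mean has positive height. All folded means share their spine
coordinates. If every leaf other than `k` has nonpositive mean height, the global minimizer is
therefore `mk (convexProj (foldedMean μ k)) k` (`isFrechetMean_iff`).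

A barycenter is the Fréchet mean of the empirical measure, so the same formula expresses `b_N`
through an ordinary average in `ℝ^{d+1}` (`empiricalMean_eq`). By the strong law, strict signs of
the moments are almost surely inherited by the empirical heights for large `N`. In each of the three
cases this fixes a leaf whose formula is eventually valid. Since `convexProj` commutes with scaling
by `√N`, test functions of `b_N` eventually equal bounded continuous functions of a normalized
Euclidean sum, and the multivariate central limit theorem applies.

In the partly sticky case, a third leaf of positive mass makes all other moments strictly negative.
The limit is then the image of `g_k` under `convexProj`. It is identified with `h_k` because `g_S`
is the projection of `g_k` to the spine and `g_k` does not charge the hyperplane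
(`spinocostalLimit_eq`). -/

lemma exists_eq_mk (q : OpenBook d K) : ∃ (x : HalfSpace d) (k : Fin K), q = mk x k := by
  obtain ⟨⟨x, k⟩, rfl⟩ := Quotient.exists_rep q
  exact ⟨x, k, rfl⟩

lemma dist_mk_left (x : HalfSpace d) (k : Fin K) (q : OpenBook d K) :
    dist (mk x k) q = ‖x.1 - fold k q‖ := by
  change bookDist (mk x k) q = _
  rw [bookDist_mk_left, fold_mk_self]

lemma mk_eq_mk_of_zero {x : HalfSpace d} (h : x.1 0 = 0) (j k : Fin K) :
    (mk x j : OpenBook d K) = mk x k :=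
  Quotient.sound (Or.inr ⟨h, rfl⟩)

lemma isometry_mk (k : Fin K) : Isometry (fun x : HalfSpace d => (mk x k : OpenBook d K)) :=
  Isometry.of_dist_eq fun x y => by
    rw [dist_mk_left, fold_mk_self, Subtype.dist_eq, dist_eq_norm]

lemma continuous_mk (k : Fin K) : Continuous (fun x : HalfSpace d => (mk x k : OpenBook d K)) :=
  (isometry_mk k).continuous

lemma lipschitzWith_fold (k : Fin K) :
    LipschitzWith 1 (fold k : OpenBook d K → Ambient d) :=
  LipschitzWith.of_dist_le_mul fun p q => by
    rw [dist_eq_norm, NNReal.coe_one, one_mul]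
    exact norm_fold_sub_le k p q

lemma continuous_fold (k : Fin K) : Continuous (fold k : OpenBook d K → Ambient d) :=
  (lipschitzWith_fold k).continuous

lemma continuous_projS : Continuous (projS : Ambient d → Spine d) := by
  unfold projS
  fun_prop

lemma continuous_spineHalf : Continuous (spineHalf : Spine d → HalfSpace d) := by
  refine Continuous.subtype_mk ?_ _
  unfold pt
  refine (PiLp.continuous_toLp 2 _).comp (continuous_pi fun i => ?_)
  refine Fin.cases ?_ (fun i => ?_) i
  · exact continuous_const
  · simp only [Fin.cons_succ]
    fun_prop

lemma spineProj_eq (k : Fin K) (q : OpenBook d K) : spineProj q = projS (fold k q) := by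
  obtain ⟨x, j, rfl⟩ := exists_eq_mk q
  change projS x.1 = _
  by_cases h : j = k
  · rw [h, fold_mk_self]
  · rw [fold_mk_of_ne _ h]
    ext i
    simp

/-- On leaves `j` and `k` the two heights cancel; on any other leaf both are nonpositive. -/
lemma fold_zero_add_le (q : OpenBook d K) {j k : Fin K} (h : j ≠ k) :
    fold j q 0 + fold k q 0 ≤ 0 := by
  obtain ⟨x, i, rfl⟩ := exists_eq_mk q
  have hx := x.2
  by_cases hj : i = j
  · subst hj
    rw [fold_mk_self, fold_mk_of_ne _ h, reflect_zero]
    simp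
  · rw [fold_mk_of_ne _ hj, reflect_zero]
    by_cases hk : i = k
    · subst hk
      rw [fold_mk_self]
      simp
    · rw [fold_mk_of_ne _ hk, reflect_zero]
      linarith

lemma fold_zero_add_lt {q : OpenBook d K} {i j k : Fin K} (hj : i ≠ j) (hk : i ≠ k)
    (hq : q ∈ openLeaf d i) : fold j q 0 + fold k q 0 < 0 := by
  obtain ⟨x, hx, rfl⟩ := hq
  rw [fold_mk_of_ne _ hj, fold_mk_of_ne _ hk, reflect_zero]
  linarith

lemma fold_zero_pos {q : OpenBook d K} {k : Fin K} (hq : q ∈ openLeaf d k) :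
    0 < fold k q 0 := by
  obtain ⟨x, hx, rfl⟩ := hq
  rwa [fold_mk_self]

lemma continuous_spineProj [hK : Fact (3 ≤ K)] :
    Continuous (spineProj : OpenBook d K → Spine d) := by
  have h : (spineProj : OpenBook d K → Spine d) = projS ∘ fold ⟨0, by have := hK.out; omega⟩ :=
    funext fun q => spineProj_eq _ q
  rw [h]
  exact continuous_projS.comp (continuous_fold _)

lemma convexProj_zero (x : Ambient d) : (convexProj x).1 0 = max (x 0) 0 := by
  unfold convexProj
  split_ifs with h
  · exact (max_eq_right h.le).symm
  · exact (max_eq_left (not_lt.1 h)).symm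

lemma convexProj_succ (x : Ambient d) (i : Fin d) : (convexProj x).1 i.succ = x i.succ := by
  unfold convexProj
  split_ifs with h
  · rfl
  · rfl

lemma ambient_ext {x y : Ambient d} (h0 : x 0 = y 0) (h : ∀ i : Fin d, x i.succ = y i.succ) :
    x = y := by
  ext i
  exact Fin.cases h0 h i

lemma projS_convexProj (x : Ambient d) : projS (convexProj x).1 = projS x := by
  ext i
  simp [convexProj_succ]

lemma convexProj_of_nonneg {x : Ambient d} (h : 0 ≤ x 0) : (convexProj x).1 = x :=
  ambient_ext (by rw [convexProj_zero, max_eq_left h]) (convexProj_succ x)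

lemma convexProj_of_nonpos {x : Ambient d} (h : x 0 ≤ 0) :
    convexProj x = spineHalf (projS x) :=
  Subtype.ext <| ambient_ext (by rw [convexProj_zero, max_eq_right h]; rfl)
    fun i => by rw [convexProj_succ]; rfl

lemma continuous_convexProj : Continuous (convexProj : Ambient d → HalfSpace d) := by
  refine continuous_induced_rng.2 ?_
  have h : (Subtype.val ∘ convexProj : Ambient d → Ambient d) =
      fun x => WithLp.toLp 2 fun i => (convexProj x).1 i := rfl
  rw [h]
  refine (PiLp.continuous_toLp 2 _).comp (continuous_pi fun i => ?_)
  refine Fin.cases ?_ (fun i => ?_) i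
  · simp only [convexProj_zero]
    fun_prop
  · simp only [convexProj_succ]
    fun_prop

/-- The half-space is a cone, so projecting onto it commutes with nonnegative scaling. This moves
the factor `√N` inside the projection. -/
lemma smul_mk_convexProj (c : ℝ≥0) (x : Ambient d) (k : Fin K) :
    c • (mk (convexProj x) k : OpenBook d K) = mk (convexProj ((c : ℝ) • x)) k := by
  have h : (⟨(c : ℝ) • (convexProj x).1, mul_nonneg c.2 (convexProj x).2⟩ : HalfSpace d) =
      convexProj ((c : ℝ) • x) := by
    refine Subtype.ext (ambient_ext ?_ fun i => ?_)
    · rw [convexProj_zero]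
      simp only [PiLp.smul_apply, smul_eq_mul, convexProj_zero]
      rw [mul_max_of_nonneg _ _ c.coe_nonneg, mul_zero]
    · simp [convexProj_succ]
  rw [← h]
  rfl

lemma spinePt_zero_eq [Fact (3 ≤ K)] (k : Fin K) :
    (spinePt 0 : OpenBook d K) = mk (spineHalf 0) k :=
  mk_eq_mk_of_zero rfl _ _

lemma dist_spinePt_zero [Fact (3 ≤ K)] (k : Fin K) (q : OpenBook d K) :
    dist (spinePt 0) q = ‖fold k q‖ := by
  have h : (spineHalf (0 : Spine d)).1 = 0 := ambient_ext rfl fun _ => rfl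
  rw [spinePt_zero_eq k, dist_mk_left, h, zero_sub, norm_neg]

/-! ### Minimizers of the Fréchet function -/

/-- The mean of `μ` folded along the `k`-th leaf. -/
noncomputable def foldedMean (μ : Measure (OpenBook d K)) (k : Fin K) : Ambient d := ∫ q, fold k q ∂μ

section Minimizer

variable [hK : Fact (3 ≤ K)] {μ : Measure (OpenBook d K)}

lemma memLp_fold (hμ : FiniteSecondMoment μ) (k : Fin K) :
    MemLp (fun q => fold k q) 2 μ := by
  rw [memLp_two_iff_integrable_sq_norm (continuous_fold k).aestronglyMeasurable]
  simpa only [FiniteSecondMoment, dist_spinePt_zero k] using hμ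

variable [IsProbabilityMeasure μ]

lemma integrable_fold (hμ : FiniteSecondMoment μ) (k : Fin K) :
    Integrable (fun q => fold k q) μ :=
  (memLp_fold hμ k).integrable (by norm_num)

lemma integrable_fold_apply (hμ : FiniteSecondMoment μ) (k : Fin K) (i : Fin (d + 1)) :
    Integrable (fun q => fold k q i) μ :=
  (EuclideanSpace.proj (𝕜 := ℝ) i).integrable_comp (integrable_fold hμ k)

lemma foldedMean_apply (hμ : FiniteSecondMoment μ) (k : Fin K) (i : Fin (d + 1)) :
    foldedMean μ k i = ∫ q, fold k q i ∂μ :=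
  ((EuclideanSpace.proj (𝕜 := ℝ) i).integral_comp_comm (integrable_fold hμ k)).symm

lemma foldedMean_succ_eq (hμ : FiniteSecondMoment μ) (j k : Fin K) (i : Fin d) :
    foldedMean μ j i.succ = foldedMean μ k i.succ := by
  rw [foldedMean_apply hμ, foldedMean_apply hμ]
  congr with q
  rw [← projS_apply, ← projS_apply, ← spineProj_eq, ← spineProj_eq]

lemma projS_foldedMean_eq (hμ : FiniteSecondMoment μ) (j k : Fin K) :
    projS (foldedMean μ j) = projS (foldedMean μ k) := by
  ext i
  exact foldedMean_succ_eq hμ j k i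

lemma foldedMean_zero_add_le (hμ : FiniteSecondMoment μ) {j k : Fin K} (h : j ≠ k) :
    foldedMean μ j 0 + foldedMean μ k 0 ≤ 0 := by
  rw [foldedMean_apply hμ, foldedMean_apply hμ,
    ← integral_add (integrable_fold_apply hμ _ _) (integrable_fold_apply hμ _ _)]
  exact integral_nonpos fun q => fold_zero_add_le q h

/-- A positive mean height forces the others to be nonpositive. If none is positive, any leaf will
do. -/
lemma exists_dominant_leaf (hμ : FiniteSecondMoment μ) :
    ∃ k : Fin K, ∀ i ≠ k, foldedMean μ i 0 ≤ 0 := by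
  by_cases h : ∃ k, 0 < foldedMean μ k 0
  · obtain ⟨k, hk⟩ := h
    exact ⟨k, fun i hi => by linarith [foldedMean_zero_add_le hμ hi]⟩
  · push Not at h
    exact ⟨⟨0, by have := hK.out; omega⟩, fun i _ => h i⟩

/-- The last summand is the same for all leaves, because `‖fold k q‖` is the distance from the
origin to `q` for every `k`. Values on different leaves thus become comparable. -/
lemma integral_dist_sq (hμ : FiniteSecondMoment μ) (x : HalfSpace d) (k : Fin K) :
    ∫ q, dist (mk x k) q ^ 2 ∂μ =
      ‖x.1 - foldedMean μ k‖ ^ 2 - ‖foldedMean μ k‖ ^ 2 + ∫ q, dist (spinePt 0) q ^ 2 ∂μ := by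
  have h : ∀ q : OpenBook d K, dist (mk x k) q ^ 2 =
      ‖x.1‖ ^ 2 - 2 * inner ℝ x.1 (fold k q) + dist (spinePt 0) q ^ 2 := fun q => by
    rw [dist_mk_left, norm_sub_sq_real, dist_spinePt_zero k]
  have hi : Integrable (fun q => inner ℝ x.1 (fold k q)) μ :=
    (integrable_fold hμ k).const_inner _
  simp_rw [h]
  rw [integral_add (f := fun q => ‖x.1‖ ^ 2 - 2 * inner ℝ x.1 (fold k q))
      ((integrable_const _).sub (hi.const_mul 2)) hμ, integral_sub (integrable_const _) (hi.const_mul 2), integral_const_mul,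
    integral_inner (integrable_fold hμ k), norm_sub_sq_real]
  simp [foldedMean]

/-- Phrased with `≤` so that minimality and uniqueness of the candidate both follow: a competitor
that is no worse must coincide with it. -/
lemma eq_of_integral_dist_sq_le (hμ : FiniteSecondMoment μ) {k : Fin K}
    (hk : ∀ i ≠ k, foldedMean μ i 0 ≤ 0) {q : OpenBook d K}
    (hq : ∫ r, dist q r ^ 2 ∂μ ≤ ∫ r, dist (mk (convexProj (foldedMean μ k)) k) r ^ 2 ∂μ) :
    q = mk (convexProj (foldedMean μ k)) k := by
  obtain ⟨x, j, rfl⟩ := exists_eq_mk q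
  set b := convexProj (foldedMean μ k) with hb
  have hx : 0 ≤ x.1 0 := x.2
  -- Height is separated from the spine coordinates, since only the height of the folded mean
  -- depends on the leaf.
  have expand : ∀ y v : Ambient d, ‖y - v‖ ^ 2 - ‖v‖ ^ 2 =
      y 0 ^ 2 - 2 * y 0 * v 0 + ∑ i : Fin d, (y i.succ - v i.succ) ^ 2 -
        ∑ i : Fin d, v i.succ ^ 2 := fun y v => by
    rw [norm_sub_sq, EuclideanSpace.real_norm_sq_eq, Fin.sum_univ_succ]
    ring
  rw [integral_dist_sq hμ, integral_dist_sq hμ, expand, expand] at hq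
  simp only [foldedMean_succ_eq hμ j k, hb, convexProj_succ, convexProj_zero, sub_self] at hq
  set a := max (foldedMean μ k 0) 0 with ha
  have ha0 : 0 ≤ a := le_max_right _ _
  have hma : foldedMean μ k 0 ≤ a := le_max_left _ _
  -- Complementarity for the projection onto `[0, ∞)`: either `a` is the mean height or `a = 0`.
  have haa : a * foldedMean μ k 0 = a * a := by
    rcases le_total 0 (foldedMean μ k 0) with h | h
    · rw [ha, max_eq_left h]
    · rw [ha, max_eq_right h]; simp
  have hS : 0 ≤ ∑ i : Fin d, (x.1 i.succ - foldedMean μ k i.succ) ^ 2 :=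
    Finset.sum_nonneg fun i _ => sq_nonneg _
  have hq' : x.1 0 ^ 2 - 2 * x.1 0 * foldedMean μ j 0 + a ^ 2 +
      ∑ i : Fin d, (x.1 i.succ - foldedMean μ k i.succ) ^ 2 ≤ 0 := by
    simp only [ne_eq, OfNat.ofNat_ne_zero, not_false_eq_true, zero_pow,
      Finset.sum_const_zero] at hq
    linarith
  have main : x.1 0 = a ∧ (j = k ∨ x.1 0 = 0) ∧
      ∑ i : Fin d, (x.1 i.succ - foldedMean μ k i.succ) ^ 2 = 0 := by
    -- On leaf `k` the inequality completes to the square `(x 0 - a) ^ 2`. On another leaf every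
    -- term is nonnegative, so all vanish and the competitor lies on the spine, where the leaf label
    -- is immaterial.
    by_cases hjk : j = k
    · subst hjk
      have h1 : x.1 0 * foldedMean μ j 0 ≤ x.1 0 * a := mul_le_mul_of_nonneg_left hma hx
      have h2 : (x.1 0 - a) ^ 2 = 0 := le_antisymm (by linarith) (sq_nonneg _)
      exact ⟨sub_eq_zero.1 (pow_eq_zero_iff two_ne_zero |>.1 h2), Or.inl rfl,
        le_antisymm (by linarith) hS⟩
    · have h1 : x.1 0 * foldedMean μ j 0 ≤ 0 := mul_nonpos_of_nonneg_of_nonpos hx (hk j hjk)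
      have h2 : x.1 0 = 0 := pow_eq_zero_iff two_ne_zero |>.1
        (le_antisymm (by linarith [sq_nonneg a]) (sq_nonneg _))
      have h3 : a = 0 := pow_eq_zero_iff two_ne_zero |>.1
        (le_antisymm (by linarith [sq_nonneg (x.1 0)]) (sq_nonneg _))
      exact ⟨h2.trans h3.symm, Or.inr h2,
        le_antisymm (by linarith [sq_nonneg (x.1 0), sq_nonneg a]) hS⟩
  obtain ⟨h0, hj, hs⟩ := main
  have hxb : x = b := by
    refine Subtype.ext (ambient_ext ?_ fun i => ?_)
    · rw [h0, hb, convexProj_zero]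
    · rw [hb, convexProj_succ]
      have := (Finset.sum_eq_zero_iff_of_nonneg fun i _ => sq_nonneg _).1 hs i (Finset.mem_univ i)
      exact sub_eq_zero.1 (pow_eq_zero_iff two_ne_zero |>.1 this)
  rw [hxb]
  rcases hj with rfl | hj
  · rfl
  · exact mk_eq_mk_of_zero (hxb ▸ hj) _ _

lemma isFrechetMean_iff (hμ : FiniteSecondMoment μ) {k : Fin K}
    (hk : ∀ i ≠ k, foldedMean μ i 0 ≤ 0) (b : OpenBook d K) :
    IsFrechetMean μ b ↔ b = mk (convexProj (foldedMean μ k)) k := by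
  refine ⟨fun h => eq_of_integral_dist_sq_le hμ hk (h _), ?_⟩
  rintro rfl p
  by_contra h
  push Not at h
  exact h.ne (by rw [eq_of_integral_dist_sq_le hμ hk h.le])

lemma existsUnique_isFrechetMean (hμ : FiniteSecondMoment μ) :
    ∃! b : OpenBook d K, IsFrechetMean μ b := by
  obtain ⟨k, hk⟩ := exists_dominant_leaf hμ
  exact ⟨_, (isFrechetMean_iff hμ hk _).2 rfl, fun b hb => (isFrechetMean_iff hμ hk b).1 hb⟩

lemma frechetMean_eq (hμ : FiniteSecondMoment μ) {k : Fin K}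
    (hk : ∀ i ≠ k, foldedMean μ i 0 ≤ 0) :
    frechetMean μ = mk (convexProj (foldedMean μ k)) k :=
  (isFrechetMean_iff hμ hk _).1
    (Classical.epsilon_spec (existsUnique_isFrechetMean hμ).exists)

lemma spineProj_frechetMean (hμ : FiniteSecondMoment μ) (k : Fin K) :
    spineProj (frechetMean μ) = projS (foldedMean μ k) := by
  obtain ⟨j, hj⟩ := exists_dominant_leaf hμ
  rw [frechetMean_eq hμ hj, spineProj_eq j, fold_mk_self, projS_convexProj,
    projS_foldedMean_eq hμ j k]

end Minimizer

/-! ### Empirical measures -/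

/-- The empirical measure of a finite sample. -/
noncomputable def empiricalMeasure {N : ℕ} (x : Fin N → OpenBook d K) : Measure (OpenBook d K) :=
  (N : ENNReal)⁻¹ • ∑ n, Measure.dirac (x n)

section Empirical

variable {N : ℕ}

lemma isProbabilityMeasure_empiricalMeasure (hN : 1 ≤ N) (x : Fin N → OpenBook d K) :
    IsProbabilityMeasure (empiricalMeasure x) := by
  constructor
  simp only [empiricalMeasure, Measure.smul_apply, Measure.finsetSum_apply, measure_univ,
    Finset.sum_const, Finset.card_univ, Fintype.card_fin, nsmul_eq_mul, mul_one, smul_eq_mul]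
  exact ENNReal.inv_mul_cancel (by simp; omega) (by simp)

lemma integrable_empiricalMeasure {E : Type*} [NormedAddCommGroup E]
    (hN : 1 ≤ N) (x : Fin N → OpenBook d K) {f : OpenBook d K → E}
    (hf : StronglyMeasurable f) : Integrable f (empiricalMeasure x) := by
  refine Integrable.smul_measure ?_ (by simp; omega)
  rw [integrable_finsetSum_measure]
  exact fun n _ => integrable_dirac' hf (by simp)

lemma integral_empiricalMeasure {E : Type*} [NormedAddCommGroup E] [NormedSpace ℝ E]
    [CompleteSpace E] (x : Fin N → OpenBook d K) {f : OpenBook d K → E}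
    (hf : StronglyMeasurable f) :
    ∫ q, f q ∂(empiricalMeasure x) = (N : ℝ)⁻¹ • ∑ n, f (x n) := by
  rw [empiricalMeasure, integral_smul_measure, integral_finsetSum_measure]
  · simp only [ENNReal.toReal_inv, ENNReal.toReal_natCast]
    congr 1
    exact Finset.sum_congr rfl fun n _ => integral_dirac' f _ hf
  · exact fun n _ => integrable_dirac' hf (by simp)

lemma foldedMean_empiricalMeasure (x : Fin N → OpenBook d K) (k : Fin K) :
    foldedMean (empiricalMeasure x) k = (N : ℝ)⁻¹ • ∑ n, fold k (x n) :=
  integral_empiricalMeasure x (continuous_fold k).stronglyMeasurable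

lemma isBarycenter_iff (hN : 1 ≤ N) (x : Fin N → OpenBook d K) (b : OpenBook d K) :
    IsBarycenter x b ↔ IsFrechetMean (empiricalMeasure x) b := by
  have hN' : (0 : ℝ) < (N : ℝ)⁻¹ := by positivity
  refine forall_congr' fun p => ?_
  rw [integral_empiricalMeasure, integral_empiricalMeasure, smul_eq_mul, smul_eq_mul,
    mul_le_mul_iff_right₀ hN']
  · exact (by fun_prop : Continuous fun q : OpenBook d K => dist p q ^ 2).stronglyMeasurable
  · exact (by fun_prop : Continuous fun q : OpenBook d K => dist b q ^ 2).stronglyMeasurable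

variable [Fact (3 ≤ K)]

lemma finiteSecondMoment_empiricalMeasure (hN : 1 ≤ N) (x : Fin N → OpenBook d K) :
    FiniteSecondMoment (empiricalMeasure x) :=
  integrable_empiricalMeasure hN x
    (by fun_prop : Continuous fun q : OpenBook d K => dist (spinePt 0) q ^ 2).stronglyMeasurable

lemma existsUnique_isBarycenter (hN : 1 ≤ N) (x : Fin N → OpenBook d K) :
    ∃! b : OpenBook d K, IsBarycenter x b := by
  have := isProbabilityMeasure_empiricalMeasure hN x
  simp_rw [isBarycenter_iff hN]
  exact existsUnique_isFrechetMean (finiteSecondMoment_empiricalMeasure hN x)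

lemma barycenter_eq_frechetMean (hN : 1 ≤ N) (x : Fin N → OpenBook d K) :
    barycenter x = frechetMean (empiricalMeasure x) := by
  unfold barycenter frechetMean
  congr 1
  exact funext fun b => propext (isBarycenter_iff hN x b)

end Empirical

/-! ### The multivariate central limit theorem -/

section CentralLimit

variable {ι : Type*} [Fintype ι]

/-- The matrix of second moments of `ν` about `a`. -/
noncomputable def secondMoments (ν : Measure (EuclideanSpace ℝ ι)) (a : EuclideanSpace ℝ ι) :
    Matrix ι ι ℝ :=
  Matrix.of fun i j => ∫ x, (x i - a i) * (x j - a j) ∂ν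

variable {ν : Measure (EuclideanSpace ℝ ι)} [IsProbabilityMeasure ν]

/-- The quadratic form of the second-moment matrix gives both its positivity and the variances of
one-dimensional projections. -/
lemma dotProduct_secondMoments (hν : MemLp id 2 ν) (a t : EuclideanSpace ℝ ι) :
    t.ofLp ⬝ᵥ (secondMoments ν a).mulVec t.ofLp = ∫ x, (inner ℝ t (x - a)) ^ 2 ∂ν := by
  have hm : ∀ i, MemLp (fun x : EuclideanSpace ℝ ι => x i - a i) 2 ν := fun i =>
    ((EuclideanSpace.proj (𝕜 := ℝ) i).comp_memLp' hν).sub (memLp_const _)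
  have hi : ∀ i j, Integrable (fun x : EuclideanSpace ℝ ι =>
      t i * ((x i - a i) * (x j - a j) * t j)) ν := fun i j =>
    (((hm i).integrable_mul (hm j)).mul_const _).const_mul _
  have hx : ∀ x : EuclideanSpace ℝ ι, (inner ℝ t (x - a)) ^ 2 =
      ∑ i, ∑ j, t i * ((x i - a i) * (x j - a j) * t j) := fun x => by
    rw [PiLp.inner_apply, sq, Finset.sum_mul_sum]
    refine Finset.sum_congr rfl fun i _ => Finset.sum_congr rfl fun j _ => ?_
    simp only [RCLike.inner_apply, PiLp.sub_apply, conj_trivial]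
    ring
  simp_rw [hx]
  rw [integral_finsetSum _ fun i _ => integrable_finsetSum _ fun j _ => hi i j]
  simp only [dotProduct, Matrix.mulVec, secondMoments, Matrix.of_apply]
  refine Finset.sum_congr rfl fun i _ => ?_
  rw [integral_finsetSum _ fun j _ => hi i j, Finset.mul_sum]
  refine Finset.sum_congr rfl fun j _ => ?_
  rw [integral_const_mul, integral_mul_const]

lemma posSemidef_secondMoments (hν : MemLp id 2 ν) (a : EuclideanSpace ℝ ι) :
    (secondMoments ν a).PosSemidef := by
  refine Matrix.PosSemidef.of_dotProduct_mulVec_nonneg ?_ fun v => ?_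
  · ext i j
    simp [secondMoments, mul_comm]
  · have := dotProduct_secondMoments hν a (WithLp.toLp 2 v)
    simp only [star_trivial]
    exact this ▸ integral_nonneg fun x => sq_nonneg _

variable [DecidableEq ι] {Ω : Type*} [MeasurableSpace Ω] {P : Measure Ω} [IsProbabilityMeasure P]

/-- Cramér–Wold: the characteristic function of the vector sum at `t` is that of the normalized real
sum of `inner ℝ t (X n)` at `1`, to which the one-dimensional theorem applies. -/
lemma tendsto_charFun_centeredSum {X : ℕ → Ω → EuclideanSpace ℝ ι}
    (hX : ∀ n, Measurable (X n)) (hlaw : ∀ n, P.map (X n) = ν) (hind : iIndepFun X P)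
    (hν : MemLp id 2 ν) (t : EuclideanSpace ℝ ι) :
    Tendsto (fun N : ℕ => charFun (P.map fun ω =>
        √(N : ℝ) • ((N : ℝ)⁻¹ • ∑ n : Fin N, X n ω - ∫ x, x ∂ν)) t) atTop
      (𝓝 (charFun (multivariateGaussian 0 (secondMoments ν (∫ x, x ∂ν))) t)) := by
  set a := ∫ x, x ∂ν with ha
  set Y : ℕ → Ω → ℝ := fun n ω => inner ℝ t (X n ω) with hY
  have hYm : ∀ n, Measurable (Y n) := fun n => by fun_prop
  have hXid : ∀ n, IdentDistrib (X n) (X 0) P P := fun n =>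
    ⟨(hX n).aemeasurable, (hX 0).aemeasurable, by rw [hlaw, hlaw]⟩
  have hYid : ∀ n, IdentDistrib (Y n) (Y 0) P P := fun n =>
    (hXid n).comp (u := fun x => inner ℝ t x) (by fun_prop)
  have hYind : iIndepFun Y P := hind.comp (fun _ x => inner ℝ t x) fun _ => by fun_prop
  have hX2 : MemLp (X 0) 2 P := by
    have := (hlaw 0).symm ▸ hν
    exact (memLp_map_measure_iff aestronglyMeasurable_id (hX 0).aemeasurable).1 this
  have hY2 : MemLp (Y 0) 2 P := hX2.const_inner t
  have hmean : P[Y 0] = inner ℝ t a := by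
    rw [ha, ← hlaw 0, integral_map (hX 0).aemeasurable (by fun_prop),
      ← integral_inner (hX2.integrable (by norm_num))]
  have hvar : Var[Y 0; P] = t.ofLp ⬝ᵥ (secondMoments ν a).mulVec t.ofLp := by
    rw [dotProduct_secondMoments hν, variance_eq_integral (hYm 0).aemeasurable, hmean, ← hlaw 0,
      integral_map (hX 0).aemeasurable (by fun_prop)]
    simp [hY, inner_sub_right]
  have hclt := tendstoInDistribution_inv_sqrt_mul_sum_sub (P' := gaussianReal 0 Var[Y 0; P].toNNReal)
    (Y := id) HasLaw.id hY2 hYind hYid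
  have h1 := ProbabilityMeasure.tendsto_iff_tendsto_charFun.1 hclt.tendsto 1
  simp only [ProbabilityMeasure.coe_mk, Measure.map_id] at h1
  have hlim : charFun (gaussianReal 0 Var[Y 0; P].toNNReal) 1 =
      charFun (multivariateGaussian 0 (secondMoments ν a)) t := by
    rw [charFun_multivariateGaussian (posSemidef_secondMoments hν a), charFun_gaussianReal, ← hvar]
    simp [variance_nonneg]
  rw [hlim] at h1
  refine h1.congr fun N => ?_
  rw [charFun_apply, charFun_apply, integral_map (by fun_prop) (by fun_prop),
    integral_map (by fun_prop) (by fun_prop)]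
  refine integral_congr_ae (ae_of_all _ fun ω => ?_)
  have hkey : (√(N : ℝ))⁻¹ * (∑ k ∈ Finset.range N, Y k ω - N * P[Y 0]) =
      inner ℝ (√(N : ℝ) • ((N : ℝ)⁻¹ • ∑ n : Fin N, X n ω - a)) t := by
    rw [hmean, real_inner_comm t, inner_smul_right, inner_sub_right, inner_smul_right, inner_sum,
      Fin.sum_univ_eq_sum_range (fun n => inner ℝ t (X n ω))]
    -- For `N = 0` both sides vanish, as `√0 = 0` and its inverse is `0`.
    rcases Nat.eq_zero_or_pos N with rfl | hN
    · simp
    · have hN' : (0 : ℝ) < N := by exact_mod_cast hN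
      have hs : √(N : ℝ) ≠ 0 := (Real.sqrt_pos.2 hN').ne'
      have hss : √(N : ℝ) ^ 2 = N := Real.sq_sqrt hN'.le
      simp only [hY]
      field_simp
      rw [hss]
  simp only [hkey]
  simp

theorem tendsto_integral_centeredSum {X : ℕ → Ω → EuclideanSpace ℝ ι}
    (hX : ∀ n, Measurable (X n)) (hlaw : ∀ n, P.map (X n) = ν) (hind : iIndepFun X P)
    (hν : MemLp id 2 ν) (φ : EuclideanSpace ℝ ι →ᵇ ℝ) :
    Tendsto (fun N : ℕ => ∫ ω,
        φ (√(N : ℝ) • ((N : ℝ)⁻¹ • ∑ n : Fin N, X n ω - ∫ x, x ∂ν)) ∂P) atTop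
      (𝓝 (∫ x, φ x ∂(multivariateGaussian 0 (secondMoments ν (∫ x, x ∂ν))))) := by
  have hm : ∀ N : ℕ, Measurable fun ω =>
      √(N : ℝ) • ((N : ℝ)⁻¹ • ∑ n : Fin N, X n ω - ∫ x, x ∂ν) := fun N => by fun_prop
  let Q : ℕ → ProbabilityMeasure (EuclideanSpace ℝ ι) := fun N =>
    ⟨P.map fun ω => √(N : ℝ) • ((N : ℝ)⁻¹ • ∑ n : Fin N, X n ω - ∫ x, x ∂ν),
      Measure.isProbabilityMeasure_map (hm N).aemeasurable⟩
  let Q' : ProbabilityMeasure (EuclideanSpace ℝ ι) :=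
    ⟨multivariateGaussian 0 (secondMoments ν (∫ x, x ∂ν)), inferInstance⟩
  have key : Tendsto Q atTop (𝓝 Q') :=
    ProbabilityMeasure.tendsto_iff_tendsto_charFun.2
      (tendsto_charFun_centeredSum hX hlaw hind hν)
  refine (ProbabilityMeasure.tendsto_iff_forall_integral_tendsto.1 key φ).congr fun N => ?_
  exact integral_map (hm N).aemeasurable (by fun_prop)

end CentralLimit

/-! ### Empirical means of a random sample -/

section Sample

variable {d K : ℕ} {Ω : Type*}

/-- The empirical mean of a random sequence folded along the `k`-th leaf. -/
noncomputable def empiricalFold (p : ℕ → Ω → OpenBook d K) (k : Fin K) (N : ℕ) (ω : Ω) : Ambient d :=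
  (N : ℝ)⁻¹ • ∑ n : Fin N, fold k (p n ω)

lemma projS_empiricalFold (p : ℕ → Ω → OpenBook d K) (k : Fin K) (N : ℕ) (ω : Ω) :
    projS (empiricalFold p k N ω) = (N : ℝ)⁻¹ • ∑ n : Fin N, spineProj (p n ω) := by
  ext i
  simp [empiricalFold, spineProj_eq k]

section Deterministic

variable [hK : Fact (3 ≤ K)] {N : ℕ} (hN : 1 ≤ N) (p : ℕ → Ω → OpenBook d K) (ω : Ω)
include hN

lemma empiricalMean_eq {k : Fin K} (hk : ∀ i ≠ k, empiricalFold p i N ω 0 ≤ 0) :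
    empiricalMean p N ω = mk (convexProj (empiricalFold p k N ω)) k := by
  have := isProbabilityMeasure_empiricalMeasure hN fun n : Fin N => p n ω
  rw [empiricalMean, barycenter_eq_frechetMean hN, empiricalFold, ← foldedMean_empiricalMeasure]
  refine frechetMean_eq (finiteSecondMoment_empiricalMeasure hN _) fun i hi => ?_
  rw [foldedMean_empiricalMeasure]
  exact hk i hi

lemma exists_dominant_leaf_empiricalFold :
    ∃ k : Fin K, ∀ i ≠ k, empiricalFold p i N ω 0 ≤ 0 := by
  have := isProbabilityMeasure_empiricalMeasure hN fun n : Fin N => p n ω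
  simp_rw [empiricalFold, ← foldedMean_empiricalMeasure]
  exact exists_dominant_leaf (finiteSecondMoment_empiricalMeasure hN _)

end Deterministic

variable [MeasurableSpace Ω] {p : ℕ → Ω → OpenBook d K}

lemma measurable_empiricalFold (hp : ∀ n, Measurable (p n)) (k : Fin K) (N : ℕ) :
    Measurable (empiricalFold p k N) := by
  have : ∀ n, Measurable fun ω => fold k (p n ω) := fun n =>
    (continuous_fold k).measurable.comp (hp n)
  unfold empiricalFold
  fun_prop

variable [hK : Fact (3 ≤ K)]

/-- The barycenter is defined by choice, so measurability comes from the explicit formula on the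
finitely many events that leaf `k` is dominant. These events cover the space; they may overlap, but
the formula is valid on each. -/
lemma measurable_smul_empiricalMean (hp : ∀ n, Measurable (p n)) {N : ℕ} (hN : 1 ≤ N)
    (c : ℝ≥0) : Measurable fun ω => c • empiricalMean p N ω := by
  intro s hs
  have hpre : (fun ω => c • empiricalMean p N ω) ⁻¹' s =
      ⋃ k : Fin K, {ω | ∀ i ≠ k, empiricalFold p i N ω 0 ≤ 0} ∩
        (fun ω => (mk (convexProj ((c : ℝ) • empiricalFold p k N ω)) k : OpenBook d K)) ⁻¹' s := by
    ext ω
    simp only [Set.mem_preimage, Set.mem_iUnion, Set.mem_inter_iff, Set.mem_ofPred_eq]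
    constructor
    · intro h
      obtain ⟨k, hk⟩ := exists_dominant_leaf_empiricalFold hN p ω
      refine ⟨k, hk, ?_⟩
      rwa [← smul_mk_convexProj, ← empiricalMean_eq hN p ω hk]
    · rintro ⟨k, hk, h⟩
      rwa [empiricalMean_eq hN p ω hk, smul_mk_convexProj]
  rw [hpre]
  refine MeasurableSet.iUnion fun k => MeasurableSet.inter ?_ ?_
  · simp only [Set.ofPred_forall]
    refine MeasurableSet.iInter fun i => MeasurableSet.iInter fun _ => ?_
    have h0 : Measurable fun x : Ambient d => x 0 := by fun_prop
    exact measurableSet_le (h0.comp (measurable_empiricalFold hp i N)) measurable_const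
  · have hmk : Measurable fun x : Ambient d => (mk (convexProj x) k : OpenBook d K) :=
      ((continuous_mk k).comp continuous_convexProj).measurable
    have hc : Measurable fun ω => (c : ℝ) • empiricalFold p k N ω :=
      (measurable_const_smul (c : ℝ)).comp (measurable_empiricalFold hp k N)
    exact measurableSet_preimage (hmk.comp hc) hs

lemma measurable_empiricalMean (hp : ∀ n, Measurable (p n)) {N : ℕ} (hN : 1 ≤ N) :
    Measurable (empiricalMean p N) := by
  intro s hs
  have hone : (fun ω => (1 : ℝ≥0) • empiricalMean p N ω) = empiricalMean p N := by
    funext ω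
    obtain ⟨k, hk⟩ := exists_dominant_leaf_empiricalFold hN p ω
    rw [empiricalMean_eq hN p ω hk, smul_mk_convexProj, NNReal.coe_one, one_smul]
  exact hone ▸ measurable_smul_empiricalMean hp hN 1 hs

variable {μ : Measure (OpenBook d K)} [IsProbabilityMeasure μ] {P : Measure Ω}

lemma ae_tendsto_empiricalFold (hμ : FiniteSecondMoment μ) (hp : ∀ n, Measurable (p n))
    (hlaw : ∀ n, P.map (p n) = μ) (hind : iIndepFun p P) :
    ∀ᵐ ω ∂P, ∀ k : Fin K, Tendsto (fun N => empiricalFold p k N ω 0) atTop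
      (𝓝 (foldedMean μ k 0)) := by
  refine ae_all_iff.2 fun k => ?_
  have hf : Measurable (fold k : OpenBook d K → Ambient d) := (continuous_fold k).measurable
  have hi : Integrable (fun ω => fold k (p 0 ω)) P := by
    have := integrable_fold hμ k
    rw [← hlaw 0] at this
    exact this.comp_measurable (hp 0)
  have key := strong_law_ae (μ := P) (fun n ω => fold k (p n ω)) hi
    (fun i j hij => (hind.comp (fun _ => fold k) fun _ => hf).indepFun hij)
    (fun n => (⟨(hp n).aemeasurable, (hp 0).aemeasurable, by rw [hlaw, hlaw]⟩ :
      IdentDistrib (p n) (p 0) P P).comp hf)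
  have hmean : ∫ ω, fold k (p 0 ω) ∂P = foldedMean μ k := by
    rw [foldedMean, ← hlaw 0, integral_map (hp 0).aemeasurable hf.aestronglyMeasurable]
  filter_upwards [key] with ω hω
  rw [hmean] at hω
  have := ((EuclideanSpace.proj (𝕜 := ℝ) (0 : Fin (d + 1))).continuous.tendsto _).comp hω
  refine this.congr fun N => ?_
  rw [empiricalFold, Fin.sum_univ_eq_sum_range (fun n => fold k (p n ω))]
  rfl

end Sample

/-- Bounded sequences of random variables that are almost surely eventually equal have the same
limit of expectations. -/
lemma tendsto_integral_of_ae_eventuallyEq {Ω : Type*} [MeasurableSpace Ω] {P : Measure Ω}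
    [IsProbabilityMeasure P] {f g : ℕ → Ω → ℝ} {C l : ℝ}
    (hf : ∀ᶠ N in atTop, AEStronglyMeasurable (f N) P) (hg : ∀ N, AEStronglyMeasurable (g N) P)
    (hfC : ∀ N ω, ‖f N ω‖ ≤ C) (hgC : ∀ N ω, ‖g N ω‖ ≤ C)
    (h : ∀ᵐ ω ∂P, ∀ᶠ N in atTop, f N ω = g N ω)
    (hl : Tendsto (fun N => ∫ ω, g N ω ∂P) atTop (𝓝 l)) :
    Tendsto (fun N => ∫ ω, f N ω ∂P) atTop (𝓝 l) := by
  have h0 : Tendsto (fun N => ∫ ω, (f N ω - g N ω) ∂P) atTop (𝓝 (∫ _, (0 : ℝ) ∂P)) := by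
    refine tendsto_integral_filter_of_dominated_convergence (fun _ => C + C)
      (hf.mono fun N hN => hN.sub (hg N))
      (Eventually.of_forall fun N => ae_of_all _ fun ω =>
        (norm_sub_le _ _).trans (add_le_add (hfC N ω) (hgC N ω))) (integrable_const _) ?_
    filter_upwards [h] with ω hω
    exact tendsto_const_nhds.congr' (hω.mono fun N hN => (sub_eq_zero.2 hN).symm)
  have hadd := h0.add hl
  rw [integral_zero, zero_add] at hadd
  refine hadd.congr' (hf.mono fun N hN => ?_)
  rw [integral_sub ((integrable_const C).mono' hN (ae_of_all _ (hfC N)))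
    ((integrable_const C).mono' (hg N) (ae_of_all _ (hgC N))), sub_add_cancel]

/-! ### The limit measures -/

section Limits

variable {d K : ℕ} {μ : Measure (OpenBook d K)}

lemma foldedCov_eq (k : Fin K) (a : Ambient d) :
    foldedCov μ k a = secondMoments (μ.map (fold k)) a := rfl

lemma spinalCov_eq : spinalCov μ = secondMoments (μ.map spineProj) 0 := by
  simp [spinalCov, secondMoments]

lemma spinalCov_apply (k : Fin K) (i j : Fin d) :
    spinalCov μ i j = foldedCov μ k 0 i.succ j.succ := by
  have h : (spineProj : OpenBook d K → Spine d) = projS ∘ fold k :=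
    funext fun q => spineProj_eq k q
  simp only [spinalCov, foldedCov, Matrix.of_apply]
  rw [h, ← Measure.map_map continuous_projS.measurable (continuous_fold k).measurable,
    integral_map continuous_projS.measurable.aemeasurable (by fun_prop)]
  simp

lemma integral_id_map_fold (k : Fin K) : ∫ x, x ∂(μ.map (fold k)) = foldedMean μ k :=
  integral_map (continuous_fold k).measurable.aemeasurable (by fun_prop)

lemma integral_pos_of_pos_on_openLeaf (hμ : Nondegenerate μ) {k : Fin K} {f : OpenBook d K → ℝ}
    (hf : Integrable f μ) (h0 : ∀ q, 0 ≤ f q) (hpos : ∀ q ∈ openLeaf d k, 0 < f q) :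
    0 < ∫ q, f q ∂μ := by
  rw [integral_pos_iff_support_of_nonneg h0 hf]
  exact (hμ k).trans_le (measure_mono fun q hq => (hpos q hq).ne')

variable [hK : Fact (3 ≤ K)]

lemma memLp_id_map_fold (hμ : FiniteSecondMoment μ) (k : Fin K) :
    MemLp id 2 (μ.map (fold k)) :=
  (memLp_map_measure_iff aestronglyMeasurable_id (continuous_fold k).measurable.aemeasurable).2
    (memLp_fold hμ k)

lemma norm_projS_le (x : Ambient d) : ‖projS x‖ ≤ ‖x‖ := by
  refine (sq_le_sq₀ (norm_nonneg _) (norm_nonneg _)).1 ?_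
  rw [EuclideanSpace.real_norm_sq_eq, EuclideanSpace.real_norm_sq_eq x, Fin.sum_univ_succ]
  simp only [projS_apply]
  linarith [sq_nonneg (x 0)]

lemma memLp_id_map_spineProj (hμ : FiniteSecondMoment μ) :
    MemLp id 2 (μ.map (spineProj : OpenBook d K → Spine d)) := by
  let k : Fin K := ⟨0, by have := hK.out; omega⟩
  rw [memLp_map_measure_iff aestronglyMeasurable_id continuous_spineProj.measurable.aemeasurable]
  refine (memLp_fold hμ k).of_le continuous_spineProj.aestronglyMeasurable
    (ae_of_all _ fun q => ?_)
  simp only [Function.comp_apply, id_eq, spineProj_eq k q]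
  exact norm_projS_le _

variable [IsProbabilityMeasure μ]

instance (k : Fin K) : IsProbabilityMeasure (μ.map (fold k)) :=
  Measure.isProbabilityMeasure_map (continuous_fold k).measurable.aemeasurable

instance : IsProbabilityMeasure (μ.map (spineProj : OpenBook d K → Spine d)) :=
  Measure.isProbabilityMeasure_map continuous_spineProj.measurable.aemeasurable

lemma moment_eq (hμ : FiniteSecondMoment μ) (k : Fin K) : moment μ k = foldedMean μ k 0 := by
  rw [foldedMean_apply hμ, moment, integral_map (continuous_fold k).measurable.aemeasurable
    (by fun_prop)]

lemma posSemidef_foldedCov (hμ : FiniteSecondMoment μ) (k : Fin K) (a : Ambient d) :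
    (foldedCov μ k a).PosSemidef :=
  posSemidef_secondMoments (memLp_id_map_fold hμ k) a

lemma posSemidef_spinalCov (hμ : FiniteSecondMoment μ) : (spinalCov μ).PosSemidef :=
  spinalCov_eq (μ := μ) ▸ posSemidef_secondMoments (memLp_id_map_spineProj hμ) 0

/-- With at least three leaves there is one different from `j` and `k`. Both heights are negative on
it, and it has positive mass. -/
lemma moment_add_moment_neg (hμ : Nondegenerate μ) (hμ2 : FiniteSecondMoment μ) {j k : Fin K}
    (hjk : j ≠ k) : moment μ j + moment μ k < 0 := by
  obtain ⟨i, hij, hik⟩ : ∃ i : Fin K, i ≠ j ∧ i ≠ k := by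
    by_contra! h
    have hcard : (Finset.univ : Finset (Fin K)).card ≤ ({j, k} : Finset (Fin K)).card :=
      Finset.card_le_card fun i _ => by
        by_cases hij : i = j
        · simp [hij]
        · simp [h i hij]
    have := hK.out
    have := Finset.card_le_two (a := j) (b := k)
    simp only [Finset.card_univ, Fintype.card_fin] at hcard
    omega
  have hj := integrable_fold_apply hμ2 j 0
  have hk := integrable_fold_apply hμ2 k 0
  have := integral_pos_of_pos_on_openLeaf hμ (k := i) (hj.add hk).neg
    (fun q => by
      have := fold_zero_add_le q hjk
      simp only [Pi.neg_apply, Pi.add_apply]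
      linarith)
    (fun q hq => by
      have := fold_zero_add_lt hij hik hq
      simp only [Pi.neg_apply, Pi.add_apply]
      linarith)
  simp only [Pi.neg_apply, Pi.add_apply] at this
  rw [integral_neg, integral_add hj hk] at this
  rw [moment_eq hμ2, moment_eq hμ2, foldedMean_apply hμ2, foldedMean_apply hμ2]
  linarith

/-- The covariance `C_S` is the spine block of `C_k`, so the characteristic functions agree at `t`
and `pt 0 t`. -/
lemma map_projS_costalLimit (hμ : FiniteSecondMoment μ) (k : Fin K) :
    (costalLimit μ k).map projS = spinalLimit μ := by
  have : IsProbabilityMeasure (costalLimit μ k) := by unfold costalLimit; infer_instance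
  have : IsProbabilityMeasure ((costalLimit μ k).map projS) :=
    Measure.isProbabilityMeasure_map continuous_projS.measurable.aemeasurable
  have : IsProbabilityMeasure (spinalLimit μ) := by unfold spinalLimit; infer_instance
  refine Measure.ext_of_charFun (funext fun t => ?_)
  have hmap : charFun ((costalLimit μ k).map projS) t = charFun (costalLimit μ k) (pt 0 t) := by
    rw [charFun_apply, charFun_apply, integral_map continuous_projS.measurable.aemeasurable
      (by fun_prop)]
    refine integral_congr_ae (ae_of_all _ fun x => ?_)
    have : inner ℝ (projS x) t = inner ℝ x (pt 0 t) := by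
      rw [PiLp.inner_apply, PiLp.inner_apply, Fin.sum_univ_succ]
      simp
    simp only [this]
  rw [hmap, costalLimit, spinalLimit, charFun_multivariateGaussian (posSemidef_foldedCov hμ k 0),
    charFun_multivariateGaussian (posSemidef_spinalCov hμ)]
  simp [dotProduct, Matrix.mulVec, Fin.sum_univ_succ, spinalCov_apply k]

/-- The mass of the open leaf `k` makes the transverse variance positive, and a nondegenerate real
Gaussian has no atoms. -/
lemma costalLimit_hyperplane (hμ : Nondegenerate μ) (hμ2 : FiniteSecondMoment μ) (k : Fin K) :
    costalLimit μ k {x | x 0 = 0} = 0 := by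
  have hpos : 0 < foldedCov μ k 0 0 0 := by
    have hint : Integrable (fun q => fold k q 0 * fold k q 0) μ := by
      have : MemLp (fun q => fold k q 0) 2 μ :=
        (EuclideanSpace.proj (𝕜 := ℝ) (0 : Fin (d + 1))).comp_memLp' (memLp_fold hμ2 k)
      exact this.integrable_mul this
    have := integral_pos_of_pos_on_openLeaf hμ (k := k) hint (fun q => mul_self_nonneg _)
      (fun q hq => mul_pos (fold_zero_pos hq) (fold_zero_pos hq))
    simp only [foldedCov, Matrix.of_apply]
    rw [integral_map (continuous_fold k).measurable.aemeasurable (by fun_prop)]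
    simpa using this
  have hmp := measurePreserving_eval_multivariateGaussian (μ := 0)
    (posSemidef_foldedCov hμ2 k 0) (i := 0)
  have hatoms : NullSingletonClass (gaussianReal ((0 : Ambient d) 0) (foldedCov μ k 0 0 0).toNNReal) :=
    nullSingletonClass_gaussianReal (by simpa using hpos)
  have := hmp.measure_preimage (measurableSet_singleton (0 : ℝ)).nullMeasurableSet
  rw [measure_singleton] at this
  exact this

lemma spinocostalLimit_eq (hμ : Nondegenerate μ) (hμ2 : FiniteSecondMoment μ) (k : Fin K) :
    spinocostalLimit μ k = (costalLimit μ k).map convexProj := by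
  have : IsProbabilityMeasure (costalLimit μ k) := by unfold costalLimit; infer_instance
  set g := costalLimit μ k with hg
  have hA : MeasurableSet {x : Ambient d | 0 < x 0} :=
    measurableSet_lt measurable_const (by fun_prop)
  have hS : Measurable (projS : Ambient d → Spine d) := continuous_projS.measurable
  have hsplit : g.restrict {x | 0 < x 0} + g.restrict {x | 0 < x 0}ᶜ = g :=
    Measure.restrict_add_restrict_compl hA
  have hsemi : semispinalLimit μ k = (g.restrict {x | 0 < x 0}ᶜ).map projS := by
    rw [semispinalLimit, ← map_projS_costalLimit hμ2 k, ← hg]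
    -- Subtraction of measures is truncated in general. Here the subtracted measure is a summand, so
    -- what remains is exactly the image of the part with `x 0 ≤ 0`.
    nth_rewrite 1 [← hsplit]
    rw [Measure.map_add _ _ hS, add_comm, Measure.add_sub_cancel]
  have hC : Measurable (convexProj : Ambient d → HalfSpace d) := continuous_convexProj.measurable
  have hspine : (semispinalLimit μ k).map spineHalf =
      (g.restrict {x | 0 < x 0}ᶜ).map convexProj := by
    rw [hsemi, Measure.map_map continuous_spineHalf.measurable hS]
    refine Measure.map_congr ((ae_restrict_iff' hA.compl).2 (ae_of_all _ fun x hx => ?_))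
    exact (convexProj_of_nonpos (not_lt.1 hx)).symm
  have hH : MeasurableSet {x : Ambient d | 0 ≤ x 0} :=
    measurableSet_le measurable_const (by fun_prop)
  have hcostal : g.comap (Subtype.val : HalfSpace d → Ambient d) =
      (g.restrict {x | 0 < x 0}).map convexProj := by
    have hemb : MeasurableEmbedding (Subtype.val : HalfSpace d → Ambient d) :=
      MeasurableEmbedding.subtype_coe hH
    ext s hs
    rw [hemb.comap_apply, Measure.map_apply hC hs, Measure.restrict_apply (hC hs)]
    refine measure_congr ?_
    -- The costal part lives on the closed half-space, while the splitting uses the open one. They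
    -- differ by the null hyperplane.
    have hae : ∀ᵐ x ∂g, x 0 ≠ 0 := by
      rw [ae_iff]
      simpa using costalLimit_hyperplane hμ hμ2 k
    filter_upwards [hae] with x hx
    refine propext ⟨?_, ?_⟩
    · rintro ⟨y, hy, rfl⟩
      refine ⟨?_, lt_of_le_of_ne y.2 (Ne.symm hx)⟩
      have : convexProj y.1 = y := Subtype.ext (convexProj_of_nonneg y.2)
      change convexProj y.1 ∈ s
      rwa [this]
    · rintro ⟨hxs, hx0⟩
      exact ⟨convexProj x, hxs, convexProj_of_nonneg (le_of_lt hx0)⟩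
  rw [spinocostalLimit, hspine, ← hg, hcostal, ← Measure.map_add _ _ hC,
    Measure.restrict_compl_add_restrict hA]

end Limits

/-! ### Limit theorems for the empirical means -/

section LimitTheorems

variable {d K : ℕ} [hK : Fact (3 ≤ K)] {Ω : Type*} [MeasurableSpace Ω] {P : Measure Ω}
  {p : ℕ → Ω → OpenBook d K}

lemma integral_rescaledLaw (hp : ∀ n, Measurable (p n)) (φ : OpenBook d K →ᵇ ℝ) {N : ℕ}
    (hN : 1 ≤ N) :
    ∫ q, φ q ∂(rescaledLaw P p N) =
      ∫ ω, φ (NNReal.sqrt (N : ℝ≥0) • empiricalMean p N ω) ∂P :=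
  integral_map (measurable_smul_empiricalMean hp hN _).aemeasurable
    φ.continuous.measurable.aestronglyMeasurable

lemma aestronglyMeasurable_rescaled (hp : ∀ n, Measurable (p n)) (φ : OpenBook d K →ᵇ ℝ)
    {N : ℕ} (hN : 1 ≤ N) :
    AEStronglyMeasurable (fun ω => φ (NNReal.sqrt (N : ℝ≥0) • empiricalMean p N ω)) P :=
  (φ.continuous.measurable.comp
    (measurable_smul_empiricalMean hp hN _)).aestronglyMeasurable

variable {μ : Measure (OpenBook d K)} [IsProbabilityMeasure μ] [IsProbabilityMeasure P]

lemma tendsto_integral_empiricalFold (hμ : FiniteSecondMoment μ) (hp : ∀ n, Measurable (p n))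
    (hlaw : ∀ n, P.map (p n) = μ) (hind : iIndepFun p P) (k : Fin K) (φ : Ambient d →ᵇ ℝ) :
    Tendsto (fun N : ℕ => ∫ ω, φ (√(N : ℝ) • (empiricalFold p k N ω - foldedMean μ k)) ∂P) atTop
      (𝓝 (∫ x, φ x ∂(multivariateGaussian 0 (foldedCov μ k (foldedMean μ k))))) := by
  have hf : Measurable (fold k : OpenBook d K → Ambient d) := (continuous_fold k).measurable
  have key := tendsto_integral_centeredSum (ν := μ.map (fold k)) (P := P)
    (X := fun n ω => fold k (p n ω)) (fun n => hf.comp (hp n))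
    (fun n => by rw [← hlaw n, Measure.map_map hf (hp n)]; rfl)
    (hind.comp (fun _ => fold k) fun _ => hf) (memLp_id_map_fold hμ k) φ
  rwa [integral_id_map_fold, ← foldedCov_eq] at key

lemma tendsto_integral_empiricalSpine (hμ : FiniteSecondMoment μ) (hp : ∀ n, Measurable (p n))
    (hlaw : ∀ n, P.map (p n) = μ) (hind : iIndepFun p P) {k : Fin K}
    (h0 : projS (foldedMean μ k) = 0) (φ : Spine d →ᵇ ℝ) :
    Tendsto (fun N : ℕ => ∫ ω, φ (√(N : ℝ) • projS (empiricalFold p k N ω)) ∂P) atTop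
      (𝓝 (∫ y, φ y ∂(spinalLimit μ))) := by
  have hf : Measurable (spineProj : OpenBook d K → Spine d) := continuous_spineProj.measurable
  have key := tendsto_integral_centeredSum (ν := μ.map spineProj) (P := P)
    (X := fun n ω => spineProj (p n ω)) (fun n => hf.comp (hp n))
    (fun n => by rw [← hlaw n, Measure.map_map hf (hp n)]; rfl)
    (hind.comp (fun _ => spineProj) fun _ => hf) (memLp_id_map_spineProj hμ) φ
  have hmean : ∫ y, y ∂(μ.map (spineProj : OpenBook d K → Spine d)) = 0 := by
    rw [integral_map hf.aemeasurable (by fun_prop), ← h0]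
    ext i
    rw [projS_apply, foldedMean_apply hμ]
    have hi : Integrable (spineProj : OpenBook d K → Spine d) μ :=
      ((memLp_map_measure_iff aestronglyMeasurable_id hf.aemeasurable).1
        (memLp_id_map_spineProj hμ)).integrable (by norm_num)
    have := ((EuclideanSpace.proj (𝕜 := ℝ) i).integral_comp_comm hi).symm
    refine this.trans (integral_congr_ae (ae_of_all _ fun q => ?_))
    simp [spineProj_eq k]
  rw [hmean, ← spinalCov_eq] at key
  simp only [sub_zero, ← projS_empiricalFold p k] at key
  exact key

theorem tendsto_rescaledLaw_of_sticky (hμ : FiniteSecondMoment μ) (hp : ∀ n, Measurable (p n))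
    (hlaw : ∀ n, P.map (p n) = μ) (hind : iIndepFun p P)
    (h0 : spineProj (frechetMean μ) = 0) (hs : Sticky μ) (φ : OpenBook d K →ᵇ ℝ) :
    Tendsto (fun N : ℕ => ∫ q, φ q ∂(rescaledLaw P p N)) atTop
      (𝓝 (∫ y, φ (spinePt y) ∂(spinalLimit μ))) := by
  let k : Fin K := ⟨0, lt_of_lt_of_le (by norm_num) hK.out⟩
  let ψ : Spine d →ᵇ ℝ :=
    φ.compContinuous ⟨fun y => spinePt y, (continuous_mk k).comp continuous_spineHalf⟩
  have hclt := tendsto_integral_empiricalSpine (P := P) hμ hp hlaw hind (k := k)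
    (by rw [← spineProj_frechetMean hμ, h0]) ψ
  have hE : ∀ N : ℕ, AEStronglyMeasurable
      (fun ω => ψ (√(N : ℝ) • projS (empiricalFold p k N ω))) P := fun N =>
    (ψ.continuous.measurable.comp ((measurable_const_smul (√(N : ℝ))).comp
      (continuous_projS.measurable.comp (measurable_empiricalFold hp k N)))).aestronglyMeasurable
  refine Tendsto.congr' ((eventually_ge_atTop 1).mono fun N hN =>
    (integral_rescaledLaw hp φ hN).symm) ?_
  refine tendsto_integral_of_ae_eventuallyEq (C := ‖φ‖)
    ((eventually_ge_atTop 1).mono fun N hN => aestronglyMeasurable_rescaled hp φ hN) hE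
    (fun N ω => φ.norm_coe_le_norm _) (fun N ω => φ.norm_coe_le_norm _) ?_ hclt
  filter_upwards [ae_tendsto_empiricalFold hμ hp hlaw hind] with ω hω
  -- All empirical heights become negative, so the projection lands on the spine and `b_N` sticks to
  -- it.
  have hneg : ∀ᶠ N in atTop, ∀ i : Fin K, empiricalFold p i N ω 0 < 0 :=
    eventually_all.2 fun i => (hω i).eventually_lt_const (moment_eq hμ i ▸ hs i)
  filter_upwards [hneg, eventually_ge_atTop 1] with N hN hN1
  rw [empiricalMean_eq hN1 p ω (k := k) fun i _ => (hN i).le, smul_mk_convexProj,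
    Real.coe_sqrt, NNReal.coe_natCast, convexProj_of_nonpos]
  · rfl
  · simpa using mul_nonpos_of_nonneg_of_nonpos (Real.sqrt_nonneg (N : ℝ)) (hN k).le

theorem tendsto_fold_empiricalMean_of_moment_pos (hμ : FiniteSecondMoment μ)
    (hp : ∀ n, Measurable (p n)) (hlaw : ∀ n, P.map (p n) = μ) (hind : iIndepFun p P)
    {k : Fin K} (hk : 0 < moment μ k) (φ : Ambient d →ᵇ ℝ) :
    Tendsto (fun N : ℕ => ∫ x, φ x ∂(P.map (fun ω =>
        √(N : ℝ) • (fold k (empiricalMean p N ω) - fold k (frechetMean μ))))) atTop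
      (𝓝 (∫ x, φ x ∂(multivariateGaussian 0 (foldedCov μ k (fold k (frechetMean μ)))))) := by
  rw [moment_eq hμ] at hk
  have hle : ∀ i ≠ k, foldedMean μ i 0 < 0 := fun i hi => by
    linarith [foldedMean_zero_add_le hμ hi]
  have hb : fold k (frechetMean μ) = foldedMean μ k := by
    rw [frechetMean_eq hμ fun i hi => (hle i hi).le, fold_mk_self, convexProj_of_nonneg hk.le]
  rw [hb]
  have hm : ∀ N : ℕ, 1 ≤ N → Measurable fun ω =>
      √(N : ℝ) • (fold k (empiricalMean p N ω) - foldedMean μ k) := fun N hN =>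
    (((continuous_fold k).measurable.comp (measurable_empiricalMean hp hN)).sub_const _).const_smul
      (√(N : ℝ))
  have hE : ∀ N : ℕ, AEStronglyMeasurable
      (fun ω => φ (√(N : ℝ) • (empiricalFold p k N ω - foldedMean μ k))) P := fun N =>
    (φ.continuous.measurable.comp (((measurable_empiricalFold hp k N).sub_const _).const_smul
      (√(N : ℝ)))).aestronglyMeasurable
  refine Tendsto.congr' ((eventually_ge_atTop 1).mono fun N hN => (integral_map
    (hm N hN).aemeasurable φ.continuous.measurable.aestronglyMeasurable).symm) ?_
  refine tendsto_integral_of_ae_eventuallyEq (C := ‖φ‖)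
    ((eventually_ge_atTop 1).mono fun N hN =>
      (φ.continuous.measurable.comp (hm N hN)).aestronglyMeasurable) hE
    (fun N ω => φ.norm_coe_le_norm _) (fun N ω => φ.norm_coe_le_norm _) ?_
    (tendsto_integral_empiricalFold hμ hp hlaw hind k φ)
  filter_upwards [ae_tendsto_empiricalFold hμ hp hlaw hind] with ω hω
  have hneg : ∀ᶠ N in atTop, ∀ i ≠ k, empiricalFold p i N ω 0 < 0 :=
    eventually_all.2 fun i => eventually_all.2 fun hi => (hω i).eventually_lt_const (hle i hi)
  -- The empirical height on leaf `k` is eventually positive, so the projection acts trivially and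
  -- folding `b_N` returns the Euclidean average.
  filter_upwards [hneg, (hω k).eventually_const_lt hk, eventually_ge_atTop 1] with N hN hNk hN1
  rw [empiricalMean_eq hN1 p ω (k := k) fun i hi => (hN i hi).le, fold_mk_self,
    convexProj_of_nonneg hNk.le]

theorem tendsto_rescaledLaw_of_moment_eq_zero (hnd : Nondegenerate μ)
    (hμ : FiniteSecondMoment μ) (hp : ∀ n, Measurable (p n)) (hlaw : ∀ n, P.map (p n) = μ)
    (hind : iIndepFun p P) (h0 : spineProj (frechetMean μ) = 0) {k : Fin K}
    (hk : moment μ k = 0) (φ : OpenBook d K →ᵇ ℝ) :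
    Tendsto (fun N : ℕ => ∫ q, φ q ∂(rescaledLaw P p N)) atTop
      (𝓝 (∫ x : HalfSpace d, φ (mk x k) ∂(spinocostalLimit μ k))) := by
  have hmean : foldedMean μ k = 0 := by
    refine ambient_ext (by rw [← moment_eq hμ, hk]; rfl) fun i => ?_
    rw [← projS_apply, ← spineProj_frechetMean hμ, h0]
    rfl
  have hle : ∀ i ≠ k, foldedMean μ i 0 < 0 := fun i hi => by
    rw [← moment_eq hμ]
    linarith [moment_add_moment_neg hnd hμ hi]
  let ψ : Ambient d →ᵇ ℝ := φ.compContinuous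
    ⟨fun x => mk (convexProj x) k, (continuous_mk k).comp continuous_convexProj⟩
  have hclt := tendsto_integral_empiricalFold (P := P) hμ hp hlaw hind k ψ
  rw [hmean] at hclt
  simp only [sub_zero] at hclt
  have hlim : ∫ x : HalfSpace d, φ (mk x k) ∂(spinocostalLimit μ k) =
      ∫ x, ψ x ∂(multivariateGaussian 0 (foldedCov μ k 0)) := by
    rw [spinocostalLimit_eq hnd hμ]
    exact integral_map continuous_convexProj.measurable.aemeasurable
      (φ.continuous.comp (continuous_mk k)).measurable.aestronglyMeasurable
  rw [hlim]
  have hE : ∀ N : ℕ, AEStronglyMeasurable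
      (fun ω => ψ (√(N : ℝ) • empiricalFold p k N ω)) P := fun N =>
    (ψ.continuous.measurable.comp
      ((measurable_empiricalFold hp k N).const_smul (√(N : ℝ)))).aestronglyMeasurable
  refine Tendsto.congr' ((eventually_ge_atTop 1).mono fun N hN =>
    (integral_rescaledLaw hp φ hN).symm) ?_
  refine tendsto_integral_of_ae_eventuallyEq (C := ‖φ‖)
    ((eventually_ge_atTop 1).mono fun N hN => aestronglyMeasurable_rescaled hp φ hN) hE
    (fun N ω => φ.norm_coe_le_norm _) (fun N ω => φ.norm_coe_le_norm _) ?_ hclt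
  filter_upwards [ae_tendsto_empiricalFold hμ hp hlaw hind] with ω hω
  -- Nothing is claimed about the sign of the height on leaf `k` itself: its mean is zero, so the
  -- projection remains in the test function `ψ` and passes to the limit.
  have hneg : ∀ᶠ N in atTop, ∀ i ≠ k, empiricalFold p i N ω 0 < 0 :=
    eventually_all.2 fun i => eventually_all.2 fun hi => (hω i).eventually_lt_const (hle i hi)
  filter_upwards [hneg, eventually_ge_atTop 1] with N hN hN1
  rw [empiricalMean_eq hN1 p ω (k := k) fun i hi => (hN i hi).le, smul_mk_convexProj,
    Real.coe_sqrt, NNReal.coe_natCast]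
  rfl

end LimitTheorems

end OpenBook

open OpenBook in
theorem theorem4 {d K : ℕ} [Fact (3 ≤ K)]
    (μ : Measure (OpenBook d K)) [IsProbabilityMeasure μ]
    (hμ : Nondegenerate μ) (hμ2 : FiniteSecondMoment μ)
    {Ω : Type*} [MeasurableSpace Ω] (P : Measure Ω) [IsProbabilityMeasure P]
    (p : ℕ → Ω → OpenBook d K) (hp : ∀ n, Measurable (p n))
    (hlaw : ∀ n, P.map (p n) = μ) (hind : iIndepFun p P) :
    -- well-posedness: the Fréchet mean and the empirical means
    ((∃! b : OpenBook d K, IsFrechetMean μ b) ∧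
      (∀ (N : ℕ), 1 ≤ N → ∀ x : Fin N → OpenBook d K, ∃! b : OpenBook d K, IsBarycenter x b) ∧
      (∀ N : ℕ, 1 ≤ N → Measurable (empiricalMean p N))) ∧
    -- sticky mean
    (spineProj (frechetMean μ) = 0 → Sticky μ →
      ∀ φ : OpenBook d K →ᵇ ℝ,
        Tendsto (fun N : ℕ => ∫ q, φ q ∂(rescaledLaw P p N)) atTop
          (𝓝 (∫ y, φ (spinePt y) ∂(spinalLimit μ)))) ∧
    -- nonsticky mean
    (∀ k : Fin K, 0 < moment μ k →
      ∀ φ : EuclideanSpace ℝ (Fin (d + 1)) →ᵇ ℝ,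
        Tendsto (fun N : ℕ => ∫ x, φ x ∂(P.map (fun ω =>
            √(N : ℝ) • (fold k (empiricalMean p N ω) - fold k (frechetMean μ))))) atTop
          (𝓝 (∫ x, φ x ∂(multivariateGaussian 0 (foldedCov μ k (fold k (frechetMean μ))))))) ∧
    -- partly sticky mean
    (spineProj (frechetMean μ) = 0 → ∀ k : Fin K, moment μ k = 0 →
      spinocostalLimit μ k = (costalLimit μ k).map convexProj ∧
      ∀ φ : OpenBook d K →ᵇ ℝ,
        Tendsto (fun N : ℕ => ∫ q, φ q ∂(rescaledLaw P p N)) atTop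
          (𝓝 (∫ x : HalfSpace d, φ (mk x k) ∂(spinocostalLimit μ k)))) := by
  refine ⟨⟨existsUnique_isFrechetMean hμ2, fun N hN x => existsUnique_isBarycenter hN x,
    fun N hN => measurable_empiricalMean hp hN⟩, ?_, ?_, ?_⟩
  · exact fun h0 hs φ => tendsto_rescaledLaw_of_sticky hμ2 hp hlaw hind h0 hs φ
  · exact fun k hk φ => tendsto_fold_empiricalMean_of_moment_pos hμ2 hp hlaw hind hk φ
  · exact fun h0 k hk => ⟨spinocostalLimit_eq hμ hμ2 k, fun φ =>
      tendsto_rescaledLaw_of_moment_eq_zero hμ hμ2 hp hlaw hind h0 hk φ⟩
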